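/- Let $(\mathsf Z,\mathscr Z)$ be a measurable space, $N\ge 1$, $\beta\in(0,1)$, and for $i=1,\dots,N$ let $r_i:\mathsf Z\to\mathbb R$ be measurable and let $P_i$ be a stochastic kernel on $\mathsf Z$. In each period $t=0,1,2,\dots$ an agent observes the state $Z_t$ and chooses one of $N$ alternatives; choosing $i$ yields the current payoff $r_i(Z_t)$, and $Z_{t+1}$ is then drawn from $P_i(Z_t,\cdot)$. A plan $\sigma$ is a sequence of measurable maps $\sigma_t:\mathsf Z^{t+1}\to\{1,\dots,N\}$, giving the choice $\sigma_t(Z_0,\dots,Z_t)$ in period $t$; let $\mathbb E_z^\sigma$ be the expectation for the resulting state process started at $Z_0=z$. The value function and the choice-specific continuation values are $$v^*(z)=\sup_\sigma \mathbb E^\sigma_z\sum_{t\ge 0}\beta^t r_{\sigma_t(Z_0,\dots,Z_t)}(Z_t),\qquad \psi_i^*(z)=r_i(z)+\beta\int v^*(z')\,P_i(z,dz').$$ Assume that there are a measurable $g:\mathsf Z\to[0,\infty)$ and constants $m,d\ge 0$ with $\beta m<1$ such that for all $z\in\mathsf Z$ and all $i,j\in\{1,\dots,N\}$ $$\int |r_i(z')|\,P_j(z,dz')\le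 g(z),\qquad \int g(z')\,P_i(z,dz')\le m\,g(z)+d .$$ Let $m',d'>0$ satisfy $Nm'+m>1$, $\beta(Nm'+m)<1$ and $d'\ge d/(Nm'+m-1)$, and put $k(z)=m'\sum_{i=1}^N|r_i(z)|+g(z)+d'$. Let $b_k\mathsf Z$ be the set of measurable $f:\mathsf Z\to\mathbb R$ with $\|f\|_k=\sup_z|f(z)|/k(z)<\infty$, equip $\times_{i=1}^N b_k\mathsf Z$ with the metric $\rho_k(\psi,\tilde\psi)=\max_{i}\|\psi_i-\tilde\psi_i\|_k$, and let $$(Q\psi)_i=r_i+\beta P_i(\psi_1\vee\dots\vee\psi_N),\qquad i=1,\dots,N,$$ where $(P_ih)(z)=\int h(z')\,P_i(z,dz')$. Then the decision problem is well posed: for every plan $\sigma$ and every initial state, the discounted payoff series converges almost surely and its sum is integrable, the supremum defining $v^*(z)$ is finite, $v^*$ is $P_i(z,\cdot)$-integrable for all $i$ and $z$, and $v^*=\psi_1^*\vee\dots\vee\psi_N^*$. Moreover: 1. $Q$ is a well-defined map from $\times_{i=1}^N b_k\mathsf Z$ to itself (the integrals in it are integrals of integrable functions), and it is a contraction of modulus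 $\beta(Nm'+m)$ with respect to $\rho_k$. 2. The unique fixed point of $Q$ in $\times_{i=1}^N b_k\mathsf Z$ is $\psi^*=(\psi_1^*,\dots,\psi_N^*)$. -/

import Mathlib

open MeasureTheory ProbabilityTheory

noncomputable section

namespace SeqDecision

variable {Z : Type*} [MeasurableSpace Z] {N : ℕ}

/-- A plan (nonanticipating policy): in period `t`, after observing the states `z₀, …, z_t`, it
chooses one of the `N` alternatives, measurably in the observed history. -/
structure Plan (Z : Type*) [MeasurableSpace Z] (N : ℕ) where
  act : (t : ℕ) → (Finset.Iic t → Z) → Fin N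
  measurable_act : ∀ t, Measurable (act t)

/-- The law of `Z_{t+1}` given the history `z₀, …, z_t`, when the plan `σ` is followed: it is
`P_i(z_t, ·)`, where `i` is the alternative that the plan selects in period `t`. -/
def stepKernel (P : Fin N → Kernel Z Z) (σ : Plan Z N) (t : ℕ) :
    Kernel (Finset.Iic t → Z) Z where
  toFun h := P (σ.act t h) (h ⟨t, Finset.mem_Iic.2 le_rfl⟩)
  measurable' := by
    have h1 : Measurable (fun p : Fin N × Z => P p.1 p.2) :=
      measurable_from_prod_countable_right fun i => (P i).measurable
    exact h1.comp ((σ.measurable_act t).prodMk (measurable_pi_apply _))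

instance (P : Fin N → Kernel Z Z) [∀ i, IsMarkovKernel (P i)] (σ : Plan Z N) (t : ℕ) :
    IsMarkovKernel (stepKernel P σ t) :=
  ⟨fun h => inferInstanceAs
    (IsProbabilityMeasure (P (σ.act t h) (h ⟨t, Finset.mem_Iic.2 le_rfl⟩)))⟩

/-- The law on the sequence space of the state process `(Z_t)` started at `Z₀ = z` and controlled
by the plan `σ` (Ionescu-Tulcea). -/
def law (P : Fin N → Kernel Z Z) [∀ i, IsMarkovKernel (P i)] (σ : Plan Z N) (z : Z) :
    Measure (ℕ → Z) :=
  Kernel.traj (X := fun _ => Z) (stepKernel P σ) 0 (fun _ => z)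

/-- The discounted period-`t` payoff `β ^ t * r_i(z_t)` along the state path `ω`, where `i` is the
alternative selected by `σ` in period `t`. -/
def payoff (β : ℝ) (r : Fin N → Z → ℝ) (σ : Plan Z N) (t : ℕ) (ω : ℕ → Z) : ℝ :=
  β ^ t * r (σ.act t (fun j => ω j)) (ω t)

/-- The total discounted payoff along the path `ω`. -/
def totalPayoff (β : ℝ) (r : Fin N → Z → ℝ) (σ : Plan Z N) (ω : ℕ → Z) : ℝ :=
  ∑' t, payoff β r σ t ω

/-- The expected total discounted payoff of the plan `σ` from the initial state `z`. -/
def planValue (β : ℝ) (r : Fin N → Z → ℝ) (P : Fin N → Kernel Z Z) [∀ i, IsMarkovKernel (P i)]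
    (σ : Plan Z N) (z : Z) : ℝ :=
  ∫ ω, totalPayoff β r σ ω ∂(law P σ z)

/-- The value function `v*`. -/
def valueFun (β : ℝ) (r : Fin N → Z → ℝ) (P : Fin N → Kernel Z Z) [∀ i, IsMarkovKernel (P i)]
    (z : Z) : ℝ :=
  ⨆ σ : Plan Z N, planValue β r P σ z

/-- The continuation values `ψ*_i`: the expected value of choosing alternative `i` now and
behaving optimally from the next period on. -/
def contValue (β : ℝ) (r : Fin N → Z → ℝ) (P : Fin N → Kernel Z Z) [∀ i, IsMarkovKernel (P i)]
    (i : Fin N) (z : Z) : ℝ :=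
  r i z + β * ∫ z', valueFun β r P z' ∂(P i z)

/-- The pointwise maximum `ψ_1 ∨ … ∨ ψ_N`. -/
def vmax [NeZero N] (ψ : Fin N → Z → ℝ) (z : Z) : ℝ :=
  Finset.univ.sup' Finset.univ_nonempty (fun i => ψ i z)

/-- The operator `Q`, with `(Q ψ)_i = r_i + β P_i (ψ_1 ∨ … ∨ ψ_N)`. -/
def jovanovicOp [NeZero N] (β : ℝ) (r : Fin N → Z → ℝ) (P : Fin N → Kernel Z Z)
    (ψ : Fin N → Z → ℝ) (i : Fin N) (z : Z) : ℝ :=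
  r i z + β * ∫ z', vmax ψ z' ∂(P i z)

/-- The weight function `k = m' ∑ |r_i| + g + d'`. -/
def weight (r : Fin N → Z → ℝ) (g : Z → ℝ) (m' d' : ℝ) (z : Z) : ℝ :=
  m' * ∑ i, |r i z| + g z + d'

/-- The weighted supremum norm `‖f‖_k = sup_z |f z| / k z`. -/
def wnorm (k : Z → ℝ) (f : Z → ℝ) : ℝ := ⨆ z, |f z| / k z

/-- The space `b_k Z` of measurable functions with finite `k`-weighted supremum norm. -/
def wBounded (k : Z → ℝ) : Set (Z → ℝ) :=
  {f | Measurable f ∧ BddAbove (Set.range fun z => |f z| / k z)}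

/-- The `N`-fold product of `b_k Z`. -/
def wBoundedProd (N : ℕ) (k : Z → ℝ) : Set (Fin N → Z → ℝ) := {ψ | ∀ i, ψ i ∈ wBounded k}

/-- The metric `ρ_k(ψ, φ) = max_i ‖ψ_i - φ_i‖_k` on the product. -/
def wdist [NeZero N] (k : Z → ℝ) (ψ φ : Fin N → Z → ℝ) : ℝ :=
  Finset.univ.sup' Finset.univ_nonempty (fun i => wnorm k (ψ i - φ i))

end SeqDecision

end

open Filter Topology

namespace SeqDecision

/-! ### Pointwise estimates for the maximum and for the weighted distance. -/

section Pointwise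

variable {Z : Type*} {N : ℕ} {k : Z → ℝ}

/-! Everything rests on `P_i k ≤ c k` with `c = N m' + m` and `β c < 1`, isolated in `IsWeight` and
verified in `isWeight_weight`. As the maximum is nonexpansive, `Q` contracts by `β c`, and its
iterates converge to a fixed point `ψ` (`exists_fixedPoint`). The same drift bound makes the
period-`t` payoff of any plan at most of order `(β c) ^ t` in mean, so all payoff series converge.

The link to the decision problem is a verification argument. Put `v = ψ_1 ∨ … ∨ ψ_N`. Telescoping `β
^ t E v(Z_t)` (`hasSum_sub_planValue`) writes `v z` minus the value of a plan as the sum of the mean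
discounted losses `v(Z_t) - ψ_i(Z_t)`, `i` being the choice in period `t`. Losses are nonnegative
and vanish for a plan that always picks a maximizer, so `v = v*` (`isGreatest_planValue`), and the
fixed point equation then says `ψ = ψ*`. This holds for every fixed point in the space, which also
gives uniqueness. -/

lemma wnorm_nonneg (hk : ∀ z, 0 < k z) (f : Z → ℝ) : 0 ≤ wnorm k f :=
  Real.iSup_nonneg fun z => div_nonneg (abs_nonneg _) (hk z).le

lemma wnorm_le (hk : ∀ z, 0 < k z) {f : Z → ℝ} {C : ℝ} (hC : 0 ≤ C)
    (h : ∀ z, |f z| ≤ C * k z) : wnorm k f ≤ C :=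
  Real.iSup_le (fun z => (div_le_iff₀ (hk z)).2 (h z)) hC

variable [NeZero N]

lemma le_vmax (ψ : Fin N → Z → ℝ) (i : Fin N) (z : Z) : ψ i z ≤ vmax ψ z :=
  Finset.le_sup' (fun i => ψ i z) (Finset.mem_univ i)

lemma vmax_le {ψ : Fin N → Z → ℝ} {z : Z} {C : ℝ} (h : ∀ i, ψ i z ≤ C) : vmax ψ z ≤ C :=
  Finset.sup'_le _ _ fun i _ => h i

lemma exists_eq_vmax (ψ : Fin N → Z → ℝ) (z : Z) : ∃ i, ψ i z = vmax ψ z := by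
  obtain ⟨i, -, hi⟩ := Finset.exists_mem_eq_sup' Finset.univ_nonempty (fun i => ψ i z)
  exact ⟨i, hi.symm⟩

lemma abs_vmax_le {ψ : Fin N → Z → ℝ} {z : Z} {C : ℝ} (h : ∀ i, |ψ i z| ≤ C) :
    |vmax ψ z| ≤ C := by
  obtain ⟨i, hi⟩ := exists_eq_vmax ψ z
  exact hi ▸ h i

lemma abs_vmax_sub_vmax_le {ψ φ : Fin N → Z → ℝ} {z : Z} {C : ℝ}
    (h : ∀ i, |ψ i z - φ i z| ≤ C) : |vmax ψ z - vmax φ z| ≤ C := by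
  rw [abs_sub_le_iff, sub_le_iff_le_add, sub_le_iff_le_add]
  exact ⟨vmax_le fun i => by linarith [(abs_sub_le_iff.1 (h i)).1, le_vmax φ i z],
    vmax_le fun i => by linarith [(abs_sub_le_iff.1 (h i)).2, le_vmax ψ i z]⟩

lemma wdist_nonneg (hk : ∀ z, 0 < k z) (ψ φ : Fin N → Z → ℝ) : 0 ≤ wdist k ψ φ :=
  (wnorm_nonneg hk _).trans
    (Finset.le_sup' (fun i => wnorm k (ψ i - φ i)) (Finset.mem_univ (0 : Fin N)))

lemma wdist_le (hk : ∀ z, 0 < k z) {ψ φ : Fin N → Z → ℝ} {C : ℝ} (hC : 0 ≤ C)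
    (h : ∀ i z, |ψ i z - φ i z| ≤ C * k z) : wdist k ψ φ ≤ C :=
  Finset.sup'_le _ _ fun i _ => wnorm_le hk hC (h i)

end Pointwise

variable {Z : Type*} [MeasurableSpace Z] {N : ℕ}

/-- `k` is a weight function for the decision problem: it dominates the payoffs up to the factor
`A`, and each kernel increases it in the mean by the factor `c` at most, where `β * c < 1`. -/
structure IsWeight (β : ℝ) (r : Fin N → Z → ℝ) (P : Fin N → Kernel Z Z) (k : Z → ℝ)
    (c A : ℝ) : Prop where
  discount_nonneg : 0 ≤ β
  measurable_payoff : ∀ i, Measurable (r i)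
  measurable : Measurable k
  pos : ∀ z, 0 < k z
  integrable : ∀ i z, Integrable k (P i z)
  integral_le : ∀ i z, ∫ z', k z' ∂(P i z) ≤ c * k z
  abs_payoff_le : ∀ i z, |r i z| ≤ A * k z
  growth_nonneg : 0 ≤ c
  bound_nonneg : 0 ≤ A
  discount_lt : β * c < 1

/-! ### The weighted space and its product. -/

section Weighted

variable {k : Z → ℝ}

lemma mem_wBounded_iff (hk : ∀ z, 0 < k z) {f : Z → ℝ} :
    f ∈ wBounded k ↔ Measurable f ∧ ∃ C, ∀ z, |f z| ≤ C * k z := by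
  refine and_congr_right fun _ => exists_congr fun C => ?_
  simp only [mem_upperBounds, Set.forall_mem_range, div_le_iff₀ (hk _)]

lemma abs_le_wnorm_mul (hk : ∀ z, 0 < k z) {f : Z → ℝ} (hf : f ∈ wBounded k) (z : Z) :
    |f z| ≤ wnorm k f * k z :=
  (div_le_iff₀ (hk z)).1 (le_ciSup hf.2 z)

lemma sub_mem_wBounded (hk : ∀ z, 0 < k z) {f h : Z → ℝ} (hf : f ∈ wBounded k)
    (hh : h ∈ wBounded k) : f - h ∈ wBounded k := by
  refine (mem_wBounded_iff hk).2 ⟨hf.1.sub hh.1, wnorm k f + wnorm k h, fun z => ?_⟩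
  rw [add_mul]
  exact (abs_sub _ _).trans (add_le_add (abs_le_wnorm_mul hk hf z) (abs_le_wnorm_mul hk hh z))

lemma mem_wBoundedProd_iff (hk : ∀ z, 0 < k z) {ψ : Fin N → Z → ℝ} :
    ψ ∈ wBoundedProd N k ↔
      (∀ i, Measurable (ψ i)) ∧ ∃ C, 0 ≤ C ∧ ∀ i z, |ψ i z| ≤ C * k z := by
  constructor
  · intro h
    -- The sum of the norms is a common constant that also makes sense for `N = 0`.
    refine ⟨fun i => (h i).1, ∑ i, wnorm k (ψ i),
      Finset.sum_nonneg fun i _ => wnorm_nonneg hk _, fun i z => ?_⟩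
    refine (abs_le_wnorm_mul hk (h i) z).trans (mul_le_mul_of_nonneg_right ?_ (hk z).le)
    exact Finset.single_le_sum (f := fun i => wnorm k (ψ i)) (fun i _ => wnorm_nonneg hk _)
      (Finset.mem_univ i)
  · rintro ⟨h1, C, -, h2⟩ i
    exact (mem_wBounded_iff hk).2 ⟨h1 i, C, h2 i⟩

variable [NeZero N]

lemma measurable_vmax {ψ : Fin N → Z → ℝ} (h : ∀ i, Measurable (ψ i)) : Measurable (vmax ψ) := by
  have : vmax ψ = Finset.univ.sup' Finset.univ_nonempty ψ := by
    ext z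
    rw [Finset.sup'_apply, vmax]
  rw [this]
  exact Finset.measurable_sup' _ fun i _ => h i

lemma abs_sub_le_wdist_mul (hk : ∀ z, 0 < k z) {ψ φ : Fin N → Z → ℝ}
    (hψ : ψ ∈ wBoundedProd N k) (hφ : φ ∈ wBoundedProd N k) (i : Fin N) (z : Z) :
    |ψ i z - φ i z| ≤ wdist k ψ φ * k z :=
  (abs_le_wnorm_mul hk (sub_mem_wBounded hk (hψ i) (hφ i)) z).trans
    (mul_le_mul_of_nonneg_right
      (Finset.le_sup' (fun i => wnorm k (ψ i - φ i)) (Finset.mem_univ i)) (hk z).le)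

end Weighted

/-! ### The operator: self-map, contraction, fixed point. -/

namespace IsWeight

variable {β : ℝ} {r : Fin N → Z → ℝ} {P : Fin N → Kernel Z Z} {k : Z → ℝ} {c A : ℝ}

lemma integrable_of_abs_le (W : IsWeight β r P k c A) {f : Z → ℝ} (hf : Measurable f) {C : ℝ}
    (h : ∀ z, |f z| ≤ C * k z) (i : Fin N) (z : Z) : Integrable f (P i z) :=
  ((W.integrable i z).const_mul C).mono' hf.aestronglyMeasurable (ae_of_all _ h)

lemma abs_integral_le (W : IsWeight β r P k c A) {f : Z → ℝ} {C : ℝ} (hC : 0 ≤ C)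
    (h : ∀ z, |f z| ≤ C * k z) (i : Fin N) (z : Z) :
    |∫ z', f z' ∂(P i z)| ≤ C * (c * k z) :=
  calc |∫ z', f z' ∂(P i z)| ≤ ∫ z', C * k z' ∂(P i z) :=
        Real.norm_eq_abs _ ▸
          norm_integral_le_of_norm_le ((W.integrable i z).const_mul C) (ae_of_all _ h)
    _ = C * ∫ z', k z' ∂(P i z) := integral_const_mul _ _
    _ ≤ C * (c * k z) := mul_le_mul_of_nonneg_left (W.integral_le i z) hC

variable [NeZero N]

lemma integrable_vmax (W : IsWeight β r P k c A) {ψ : Fin N → Z → ℝ}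
    (hψ : ψ ∈ wBoundedProd N k) (i : Fin N) (z : Z) : Integrable (vmax ψ) (P i z) := by
  obtain ⟨h1, C, -, h2⟩ := (mem_wBoundedProd_iff W.pos).1 hψ
  exact W.integrable_of_abs_le (measurable_vmax h1) (fun z => abs_vmax_le fun i => h2 i z) i z

lemma jovanovicOp_mem [∀ i, IsMarkovKernel (P i)] (W : IsWeight β r P k c A)
    {ψ : Fin N → Z → ℝ} (hψ : ψ ∈ wBoundedProd N k) :
    jovanovicOp β r P ψ ∈ wBoundedProd N k := by
  obtain ⟨h1, C, hC, h2⟩ := (mem_wBoundedProd_iff W.pos).1 hψ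
  have hv := measurable_vmax h1
  refine (mem_wBoundedProd_iff W.pos).2 ⟨fun i => ?_, A + β * (C * c), ?_, fun i z => ?_⟩
  · exact (W.measurable_payoff i).add
      ((hv.stronglyMeasurable.integral_kernel (κ := P i)).measurable.const_mul β)
  · exact add_nonneg W.bound_nonneg
      (mul_nonneg W.discount_nonneg (mul_nonneg hC W.growth_nonneg))
  · have h3 := W.abs_integral_le hC (fun z => abs_vmax_le fun i => h2 i z) i z
    calc |jovanovicOp β r P ψ i z| ≤ |r i z| + |β * ∫ z', vmax ψ z' ∂(P i z)| := abs_add_le _ _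
      _ = |r i z| + β * |∫ z', vmax ψ z' ∂(P i z)| := by
          rw [abs_mul, abs_of_nonneg W.discount_nonneg]
      _ ≤ A * k z + β * (C * (c * k z)) :=
          add_le_add (W.abs_payoff_le i z) (mul_le_mul_of_nonneg_left h3 W.discount_nonneg)
      _ = (A + β * (C * c)) * k z := by ring

/-- The contraction property of the operator, in pointwise form. -/
lemma abs_jovanovicOp_sub_le (W : IsWeight β r P k c A) {ψ φ : Fin N → Z → ℝ}
    (hψ : ψ ∈ wBoundedProd N k) (hφ : φ ∈ wBoundedProd N k) {C : ℝ} (hC : 0 ≤ C)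
    (h : ∀ i z, |ψ i z - φ i z| ≤ C * k z) (i : Fin N) (z : Z) :
    |jovanovicOp β r P ψ i z - jovanovicOp β r P φ i z| ≤ β * c * C * k z := by
  have h1 : jovanovicOp β r P ψ i z - jovanovicOp β r P φ i z =
      β * ∫ z', (vmax ψ z' - vmax φ z') ∂(P i z) := by
    rw [integral_sub (W.integrable_vmax hψ i z) (W.integrable_vmax hφ i z), jovanovicOp,
      jovanovicOp]
    ring
  rw [h1, abs_mul, abs_of_nonneg W.discount_nonneg]
  calc _ ≤ β * (C * (c * k z)) := mul_le_mul_of_nonneg_left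
        (W.abs_integral_le hC (fun z => abs_vmax_sub_vmax_le fun i => h i z) i z)
        W.discount_nonneg
    _ = β * c * C * k z := by ring

lemma wdist_jovanovicOp_le (W : IsWeight β r P k c A) {ψ φ : Fin N → Z → ℝ}
    (hψ : ψ ∈ wBoundedProd N k) (hφ : φ ∈ wBoundedProd N k) :
    wdist k (jovanovicOp β r P ψ) (jovanovicOp β r P φ) ≤ β * c * wdist k ψ φ :=
  wdist_le W.pos
    (mul_nonneg (mul_nonneg W.discount_nonneg W.growth_nonneg) (wdist_nonneg W.pos _ _))
    (W.abs_jovanovicOp_sub_le hψ hφ (wdist_nonneg W.pos _ _) (abs_sub_le_wdist_mul W.pos hψ hφ))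

/-- The operator has a fixed point, the limit of the iterates that start at zero. -/
lemma exists_fixedPoint [∀ i, IsMarkovKernel (P i)] (W : IsWeight β r P k c A) :
    ∃ ψ ∈ wBoundedProd N k, jovanovicOp β r P ψ = ψ := by
  set Q : (Fin N → Z → ℝ) → Fin N → Z → ℝ := jovanovicOp β r P
  set s : ℕ → Fin N → Z → ℝ := fun n => Q^[n] 0
  have hs0 : s 0 ∈ wBoundedProd N k :=
    (mem_wBoundedProd_iff W.pos).2 ⟨fun _ => measurable_const, 0, le_rfl, by simp [s]⟩
  have hsucc : ∀ n, s (n + 1) = Q (s n) := fun n => Function.iterate_succ_apply' _ _ _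
  have hs : ∀ n, s n ∈ wBoundedProd N k := fun n => by
    induction n with
    | zero => exact hs0
    | succ n ih => exact hsucc n ▸ W.jovanovicOp_mem ih
  obtain ⟨-, C, hC, hC1⟩ := (mem_wBoundedProd_iff W.pos).1 (hs 1)
  have hβc : 0 ≤ β * c := mul_nonneg W.discount_nonneg W.growth_nonneg
  have hstep : ∀ n i z, |s (n + 1) i z - s n i z| ≤ (β * c) ^ n * C * k z := fun n => by
    induction n with
    | zero => simpa [s] using hC1
    | succ n ih =>
      intro i z
      rw [hsucc (n + 1), hsucc n]
      refine (W.abs_jovanovicOp_sub_le (hsucc n ▸ hs (n + 1)) (hs n)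
        (mul_nonneg (pow_nonneg hβc n) hC) (hsucc n ▸ ih) i z).trans_eq ?_
      ring
  have hdist : ∀ i z n, dist (s n i z) (s (n + 1) i z) ≤ C * k z * (β * c) ^ n := fun i z n => by
    rw [dist_comm, Real.dist_eq]
    exact (hstep n i z).trans_eq (by ring)
  choose ψ hψ using fun i z =>
    cauchySeq_tendsto_of_complete (cauchySeq_of_le_geometric _ _ W.discount_lt (hdist i z))
  -- For `n = 0` this bounds the limit by a multiple of `k`; for general `n` it is convergence at a
  -- geometric rate in the weighted norm.
  have htail : ∀ n i z, |s n i z - ψ i z| ≤ C / (1 - β * c) * (β * c) ^ n * k z :=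
    fun n i z => by
      refine (dist_le_of_le_geometric_of_tendsto _ _ W.discount_lt (hdist i z) (hψ i z) n).trans_eq
        ?_
      ring
  have hD : 0 ≤ C / (1 - β * c) := div_nonneg hC (by linarith [W.discount_lt])
  have hmem : ψ ∈ wBoundedProd N k := by
    refine (mem_wBoundedProd_iff W.pos).2 ⟨fun i => ?_, _, hD, fun i z => ?_⟩
    · exact measurable_of_tendsto_metrizable (fun n => (hs n i).1)
        (tendsto_pi_nhds.2 fun z => hψ i z)
    · simpa [s] using htail 0 i z
  refine ⟨ψ, hmem, ?_⟩
  ext i z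
  -- The shifted iterates `s (n + 1) = Q (s n)` tend to `ψ`, and by the contraction estimate also to
  -- `Q ψ`.
  refine tendsto_nhds_unique ?_ ((tendsto_add_atTop_iff_nat 1).2 (hψ i z))
  rw [tendsto_iff_dist_tendsto_zero]
  have hz : Tendsto (fun n => β * c * (C / (1 - β * c) * (β * c) ^ n) * k z) atTop (𝓝 0) := by
    have := tendsto_pow_atTop_nhds_zero_of_lt_one hβc W.discount_lt
    simpa using ((this.const_mul (C / (1 - β * c))).const_mul (β * c)).mul_const (k z)
  refine squeeze_zero (fun n => dist_nonneg) (fun n => ?_) hz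
  rw [Real.dist_eq, hsucc n]
  exact W.abs_jovanovicOp_sub_le (hs n) hmem (mul_nonneg hD (pow_nonneg hβc n)) (htail n) i z

end IsWeight

/-- By Tonelli the sum of the norms has a finite integral, hence is finite almost everywhere. It
dominates the sum, which is measurable as an almost everywhere limit of partial sums. -/
lemma ae_summable_and_integrable_tsum {Ω : Type*} [MeasurableSpace Ω] {μ : Measure Ω}
    {F : ℕ → Ω → ℝ} (hF : ∀ n, Integrable (F n) μ) (hs : Summable fun n => ∫ ω, ‖F n ω‖ ∂μ) :
    (∀ᵐ ω ∂μ, Summable fun n => F n ω) ∧ Integrable (fun ω => ∑' n, F n ω) μ := by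
  have hfin : ∫⁻ ω, ∑' n, ‖F n ω‖ₑ ∂μ < ⊤ := by
    rw [lintegral_tsum fun n => (hF n).aestronglyMeasurable.enorm]
    simp_rw [← ofReal_integral_norm_eq_lintegral_enorm (hF _)]
    rw [← ENNReal.ofReal_tsum_of_nonneg (fun n => integral_nonneg fun ω => norm_nonneg _) hs]
    exact ENNReal.ofReal_lt_top
  have hsum : ∀ᵐ ω ∂μ, Summable fun n => F n ω := by
    filter_upwards [ae_lt_top' (AEMeasurable.tsum
      fun n => (hF n).aestronglyMeasurable.enorm) hfin.ne] with ω hω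
    refine Summable.of_norm ?_
    simpa using ENNReal.summable_toReal hω.ne
  refine ⟨hsum, ?_, ?_⟩
  · refine aestronglyMeasurable_of_tendsto_ae atTop
      (f := fun (n : ℕ) ω => ∑ i ∈ Finset.range n, F i ω) (fun n => ?_) ?_
    · exact Finset.aestronglyMeasurable_fun_sum _ fun i _ => (hF i).aestronglyMeasurable
    · filter_upwards [hsum] with ω hω using hω.hasSum.tendsto_sum_nat
  · exact (lintegral_mono fun ω => enorm_tsum_le_tsum_enorm).trans_lt hfin

variable {Z : Type*} [MeasurableSpace Z] {N : ℕ}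

/-- The alternative that the plan selects in period `t` along the state path `ω`. -/
def Plan.choice (σ : Plan Z N) (t : ℕ) (ω : ℕ → Z) : Fin N :=
  σ.act t (Preorder.frestrictLe t ω)

lemma Plan.measurable_choice (σ : Plan Z N) (t : ℕ) : Measurable (σ.choice t) :=
  (σ.measurable_act t).comp (Preorder.measurable_frestrictLe t)

lemma measurable_apply_choice (σ : Plan Z N) (t : ℕ) {f : Fin N → Z → ℝ}
    (hf : ∀ i, Measurable (f i)) : Measurable fun ω : ℕ → Z => f (σ.choice t ω) (ω t) := by
  have h : Measurable fun p : Fin N × Z => f p.1 p.2 := measurable_from_prod_countable_right hf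
  exact h.comp ((σ.measurable_choice t).prodMk (measurable_pi_apply t))

/-! ### The law of the controlled process. -/

section Law

variable (P : Fin N → Kernel Z Z) [∀ i, IsMarkovKernel (P i)] (σ : Plan Z N) (z : Z)

instance : IsProbabilityMeasure (law P σ z) :=
  inferInstanceAs (IsProbabilityMeasure (Kernel.traj (X := fun _ => Z) (stepKernel P σ) 0 _))

lemma law_map_zero : (law P σ z).map (fun ω => ω 0) = Measure.dirac z := by
  have h := Kernel.traj_map_frestrictLe_apply (X := fun _ => Z) (κ := stepKernel P σ) 0 0
    (fun _ => z)
  rw [Kernel.partialTraj_self, Kernel.id_apply] at h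
  have h2 := congrArg (Measure.map fun x : (Finset.Iic 0 → Z) => x ⟨0, by simp⟩) h
  rw [Measure.map_map (by fun_prop) (by fun_prop), Measure.map_dirac' (by fun_prop)] at h2
  exact h2

/-- One-step disintegration of the trajectory law. Together with `law_map_zero`, it is all that the
mean computations below use of the Ionescu-Tulcea construction. -/
lemma law_map_succ (t : ℕ) :
    (law P σ z).map (fun ω => (Preorder.frestrictLe t ω, ω (t + 1))) =
      ((law P σ z).map (Preorder.frestrictLe t)) ⊗ₘ stepKernel P σ t := by
  rw [law, Kernel.traj_map_frestrictLe_apply]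
  exact (Kernel.partialTraj_compProd_eq_map_traj (X := fun _ => Z) (zero_le (a := t))).symm

variable {P σ z}

lemma integrable_coord_succ {f : Z → ℝ} (hf : Measurable f) (t : ℕ)
    (hfi : ∀ i z, Integrable f (P i z))
    (h : Integrable (fun ω => ∫ z', ‖f z'‖ ∂(P (σ.choice t ω) (ω t))) (law P σ z)) :
    Integrable (fun ω => f (ω (t + 1))) (law P σ z) := by
  have hm : Measurable fun p : (Finset.Iic t → Z) × Z => f p.2 := hf.comp measurable_snd
  have h1 : Measurable fun x : (Finset.Iic t → Z) => ∫ z', ‖f z'‖ ∂(stepKernel P σ t x) :=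
    (hf.norm.stronglyMeasurable.integral_kernel (κ := stepKernel P σ t)).measurable
  have h2 : Integrable (fun p : (Finset.Iic t → Z) × Z => f p.2)
      ((law P σ z).map (fun ω => (Preorder.frestrictLe t ω, ω (t + 1)))) := by
    rw [law_map_succ, Measure.integrable_compProd_iff hm.aestronglyMeasurable]
    refine ⟨ae_of_all _ fun x => hfi _ _, ?_⟩
    rw [integrable_map_measure h1.aestronglyMeasurable (by fun_prop)]
    exact h
  exact (integrable_map_measure hm.aestronglyMeasurable (by fun_prop)).1 h2

/-- The Markov property of the controlled process. -/
lemma integral_coord_succ {f : Z → ℝ} (hf : Measurable f) (t : ℕ)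
    (h : Integrable (fun ω => f (ω (t + 1))) (law P σ z)) :
    ∫ ω, f (ω (t + 1)) ∂(law P σ z) =
      ∫ ω, ∫ z', f z' ∂(P (σ.choice t ω) (ω t)) ∂(law P σ z) := by
  have hm : Measurable fun p : (Finset.Iic t → Z) × Z => f p.2 := hf.comp measurable_snd
  have h1 : Measurable fun x : (Finset.Iic t → Z) => ∫ z', f z' ∂(stepKernel P σ t x) :=
    (hf.stronglyMeasurable.integral_kernel (κ := stepKernel P σ t)).measurable
  have h2 := (integrable_map_measure (μ := law P σ z)
    (f := fun ω : ℕ → Z => (Preorder.frestrictLe (π := fun _ => Z) t ω, ω (t + 1)))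
    hm.aestronglyMeasurable (by fun_prop)).2 h
  have h3 := integral_map (μ := law P σ z)
    (φ := fun ω : ℕ → Z => (Preorder.frestrictLe (π := fun _ => Z) t ω, ω (t + 1)))
    (by fun_prop) hm.aestronglyMeasurable
  rw [← h3]
  rw [law_map_succ] at h2 ⊢
  rw [Measure.integral_compProd h2, integral_map (by fun_prop) h1.aestronglyMeasurable]
  rfl

lemma integral_coord_zero {f : Z → ℝ} (hf : Measurable f) :
    ∫ ω, f (ω 0) ∂(law P σ z) = f z := by
  rw [← integral_map (φ := fun ω : ℕ → Z => ω 0) (measurable_pi_apply 0).aemeasurable hf.aestronglyMeasurable,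
    law_map_zero, integral_dirac' _ _ hf.stronglyMeasurable]

lemma integrable_coord_zero {f : Z → ℝ} (hf : Measurable f) :
    Integrable (fun ω => f (ω 0)) (law P σ z) := by
  refine (integrable_map_measure (f := fun ω : ℕ → Z => ω 0) hf.aestronglyMeasurable
    (measurable_pi_apply 0).aemeasurable).1 ?_
  rw [law_map_zero]
  exact integrable_dirac' hf.stronglyMeasurable (by simp)

end Law

/-! ### Expected payoffs and the verification argument. -/

namespace IsWeight

variable {β : ℝ} {r : Fin N → Z → ℝ} {P : Fin N → Kernel Z Z}
  {k : Z → ℝ} {c A : ℝ}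

lemma measurable_integral_choice (σ : Plan Z N) (t : ℕ) {f : Z → ℝ} (hf : Measurable f) :
    Measurable fun ω : ℕ → Z => ∫ z', f z' ∂(P (σ.choice t ω) (ω t)) :=
  measurable_apply_choice σ t fun i =>
    (hf.stronglyMeasurable.integral_kernel (κ := P i)).measurable

lemma summable_discount (W : IsWeight β r P k c A) (C : ℝ) (z : Z) :
    Summable fun t : ℕ => β ^ t * C * (c ^ t * k z) := by
  refine ((summable_geometric_of_lt_one (mul_nonneg W.discount_nonneg W.growth_nonneg)
    W.discount_lt).mul_left (C * k z)).congr fun t => ?_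
  rw [mul_pow]
  ring

lemma measurable_payoff_path (W : IsWeight β r P k c A) (σ : Plan Z N) (t : ℕ) :
    Measurable (payoff β r σ t) :=
  (measurable_apply_choice σ t W.measurable_payoff).const_mul _

variable [∀ i, IsMarkovKernel (P i)]

/-- The weight of the state grows in the mean by the factor `c` per period at most. -/
lemma integrable_coord_and_integral_le (W : IsWeight β r P k c A) (σ : Plan Z N) (z : Z)
    (t : ℕ) : Integrable (fun ω => k (ω t)) (law P σ z) ∧
      ∫ ω, k (ω t) ∂(law P σ z) ≤ c ^ t * k z := by
  induction t with
  | zero => exact ⟨integrable_coord_zero W.measurable, by simp [integral_coord_zero W.measurable]⟩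
  | succ t ih =>
    have h0 : ∀ i z, 0 ≤ ∫ z', k z' ∂(P i z) := fun i z =>
      integral_nonneg fun z' => (W.pos z').le
    have h1 : Integrable (fun ω => ∫ z', k z' ∂(P (σ.choice t ω) (ω t))) (law P σ z) := by
      refine (ih.1.const_mul c).mono'
        (measurable_integral_choice σ t W.measurable).aestronglyMeasurable (ae_of_all _ fun ω => ?_)
      rw [Real.norm_of_nonneg (h0 _ _)]
      exact W.integral_le _ _
    have h2 : Integrable (fun ω => k (ω (t + 1))) (law P σ z) := by
      refine integrable_coord_succ W.measurable t W.integrable ?_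
      simpa only [Real.norm_of_nonneg (W.pos _).le] using h1
    refine ⟨h2, ?_⟩
    calc ∫ ω, k (ω (t + 1)) ∂(law P σ z)
        = ∫ ω, ∫ z', k z' ∂(P (σ.choice t ω) (ω t)) ∂(law P σ z) :=
          integral_coord_succ W.measurable t h2
      _ ≤ ∫ ω, c * k (ω t) ∂(law P σ z) :=
          integral_mono h1 (ih.1.const_mul c) fun ω => W.integral_le _ _
      _ = c * ∫ ω, k (ω t) ∂(law P σ z) := integral_const_mul _ _
      _ ≤ c * (c ^ t * k z) := mul_le_mul_of_nonneg_left ih.2 W.growth_nonneg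
      _ = c ^ (t + 1) * k z := by ring

/-- Bounds in terms of the weight of the state carry over to means. -/
lemma integrable_and_integral_norm_le (W : IsWeight β r P k c A) {σ : Plan Z N} {z : Z} {t : ℕ}
    {F : (ℕ → Z) → ℝ} (hF : Measurable F) {C : ℝ} (hC : 0 ≤ C) (h : ∀ ω, |F ω| ≤ C * k (ω t)) :
    Integrable F (law P σ z) ∧ ∫ ω, ‖F ω‖ ∂(law P σ z) ≤ C * (c ^ t * k z) := by
  obtain ⟨h1, h2⟩ := W.integrable_coord_and_integral_le σ z t
  have hF' : Integrable F (law P σ z) :=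
    (h1.const_mul C).mono' hF.aestronglyMeasurable (ae_of_all _ h)
  refine ⟨hF', ?_⟩
  calc ∫ ω, ‖F ω‖ ∂(law P σ z) ≤ ∫ ω, C * k (ω t) ∂(law P σ z) :=
        integral_mono hF'.norm (h1.const_mul C) h
    _ = C * ∫ ω, k (ω t) ∂(law P σ z) := integral_const_mul _ _
    _ ≤ C * (c ^ t * k z) := mul_le_mul_of_nonneg_left h2 hC

lemma integrable_payoff_and_integral_norm_le (W : IsWeight β r P k c A) (σ : Plan Z N) (z : Z)
    (t : ℕ) : Integrable (payoff β r σ t) (law P σ z) ∧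
      ∫ ω, ‖payoff β r σ t ω‖ ∂(law P σ z) ≤ β ^ t * A * (c ^ t * k z) := by
  refine W.integrable_and_integral_norm_le (W.measurable_payoff_path σ t)
    (mul_nonneg (pow_nonneg W.discount_nonneg t) W.bound_nonneg) fun ω => ?_
  rw [payoff, abs_mul, abs_of_nonneg (pow_nonneg W.discount_nonneg t), mul_assoc]
  exact mul_le_mul_of_nonneg_left (W.abs_payoff_le _ _) (pow_nonneg W.discount_nonneg t)

lemma summable_integral_norm_payoff (W : IsWeight β r P k c A) (σ : Plan Z N) (z : Z) :
    Summable fun t => ∫ ω, ‖payoff β r σ t ω‖ ∂(law P σ z) :=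
  Summable.of_nonneg_of_le (fun _ => integral_nonneg fun _ => norm_nonneg _)
    (fun t => (W.integrable_payoff_and_integral_norm_le σ z t).2) (W.summable_discount A z)

lemma ae_summable_and_integrable_totalPayoff (W : IsWeight β r P k c A) (σ : Plan Z N) (z : Z) :
    (∀ᵐ ω ∂(law P σ z), Summable fun t => payoff β r σ t ω) ∧
      Integrable (totalPayoff β r σ) (law P σ z) :=
  ae_summable_and_integrable_tsum (fun t => (W.integrable_payoff_and_integral_norm_le σ z t).1)
    (W.summable_integral_norm_payoff σ z)

lemma hasSum_planValue (W : IsWeight β r P k c A) (σ : Plan Z N) (z : Z) :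
    HasSum (fun t => ∫ ω, payoff β r σ t ω ∂(law P σ z)) (planValue β r P σ z) :=
  hasSum_integral_of_summable_integral_norm
    (fun t => (W.integrable_payoff_and_integral_norm_le σ z t).1)
    (W.summable_integral_norm_payoff σ z)

/-- The value of a plan, and a telescoping sum with value `v z`, compared period by period: the
difference is the loss against one step of dynamic programming. -/
lemma hasSum_sub_planValue (W : IsWeight β r P k c A) {v : Z → ℝ} (hv : Measurable v) {C : ℝ}
    (hC : 0 ≤ C) (h : ∀ z, |v z| ≤ C * k z) (σ : Plan Z N) (z : Z) :
    HasSum (fun t => ∫ ω, β ^ t * (v (ω t) - (r (σ.choice t ω) (ω t) +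
        β * ∫ z', v z' ∂(P (σ.choice t ω) (ω t)))) ∂(law P σ z))
      (v z - planValue β r P σ z) := by
  have hvt : ∀ t, Integrable (fun ω => v (ω t)) (law P σ z) ∧
      ∫ ω, ‖v (ω t)‖ ∂(law P σ z) ≤ C * (c ^ t * k z) := fun t =>
    W.integrable_and_integral_norm_le (hv.comp (measurable_pi_apply t)) hC fun ω => h _
  set a : ℕ → ℝ := fun t => β ^ t * ∫ ω, v (ω t) ∂(law P σ z)
  have ha : Summable a := by
    refine Summable.of_norm_bounded (W.summable_discount C z) fun t => ?_
    rw [norm_mul, norm_pow, Real.norm_of_nonneg W.discount_nonneg, mul_assoc]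
    exact mul_le_mul_of_nonneg_left ((norm_integral_le_integral_norm _).trans (hvt t).2)
      (pow_nonneg W.discount_nonneg t)
  -- Since `a` is summable, the telescoping sum is `a 0`, the value at the deterministic initial
  -- state.
  have htel : HasSum (fun t => a t - a (t + 1)) (v z) := by
    have h0 : a 0 = v z := by simp [a, integral_coord_zero hv]
    have := ha.hasSum.sub ((hasSum_nat_add_iff' 1).2 ha.hasSum)
    simpa [h0] using this
  refine (htel.sub (W.hasSum_planValue σ z)).congr_fun fun t => ?_
  have hI : Integrable (fun ω => ∫ z', v z' ∂(P (σ.choice t ω) (ω t))) (law P σ z) := by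
    refine (W.integrable_and_integral_norm_le (t := t) (measurable_integral_choice σ t hv)
      (mul_nonneg hC W.growth_nonneg) fun ω => ?_).1
    rw [mul_assoc]
    exact W.abs_integral_le hC h _ _
  have hp := (W.integrable_payoff_and_integral_norm_le σ z t).1
  have hsplit : ∀ ω, β ^ t * (v (ω t) - (r (σ.choice t ω) (ω t) +
      β * ∫ z', v z' ∂(P (σ.choice t ω) (ω t)))) = β ^ t * v (ω t) -
      β ^ (t + 1) * (∫ z', v z' ∂(P (σ.choice t ω) (ω t))) - payoff β r σ t ω := fun ω => by
    have : payoff β r σ t ω = β ^ t * r (σ.choice t ω) (ω t) := rfl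
    rw [this]
    ring
  simp_rw [hsplit]
  have hd : Integrable (fun ω => β ^ t * v (ω t) -
      β ^ (t + 1) * ∫ z', v z' ∂(P (σ.choice t ω) (ω t))) (law P σ z) :=
    ((hvt t).1.const_mul _).sub (hI.const_mul _)
  -- The Markov property identifies the mean of the one-step integral with the mean of `v` in period
  -- `t + 1`, which produces `a (t + 1)`.
  rw [integral_sub hd hp, integral_sub ((hvt t).1.const_mul _) (hI.const_mul _), integral_const_mul,
    integral_const_mul, ← integral_coord_succ hv t (hvt (t + 1)).1]

variable [NeZero N]

/-- Ties are broken by the least maximizing index, so that each level set is a finite Boolean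
combination of the measurable sets on which `ψ j` attains the maximum. -/
lemma exists_measurable_argmax {ψ : Fin N → Z → ℝ} (hψ : ∀ i, Measurable (ψ i)) :
    ∃ s : Z → Fin N, Measurable s ∧ ∀ z, ψ (s z) z = vmax ψ z := by
  classical
  refine ⟨fun z => Fin.find (fun i => ψ i z = vmax ψ z) (exists_eq_vmax ψ z),
    measurable_to_countable' fun i => ?_, fun z => Fin.find_spec (exists_eq_vmax ψ z)⟩
  have h1 : ∀ j, MeasurableSet {z | ψ j z = vmax ψ z} := fun j =>
    measurableSet_eq_fun (hψ j) (measurable_vmax hψ)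
  have h2 : (fun z => Fin.find (fun i => ψ i z = vmax ψ z) (exists_eq_vmax ψ z)) ⁻¹' {i} =
      {z | ψ i z = vmax ψ z} ∩ ⋂ j, ⋂ _ : j < i, {z | ψ j z = vmax ψ z}ᶜ := by
    ext z
    simp [Fin.find_eq_iff]
  rw [h2]
  exact (h1 i).inter (.iInter fun j => .iInter fun _ => (h1 j).compl)

/-- A fixed point of the operator determines the value function. -/
lemma isGreatest_planValue (W : IsWeight β r P k c A) {ψ : Fin N → Z → ℝ}
    (hψ : ψ ∈ wBoundedProd N k) (hfix : jovanovicOp β r P ψ = ψ) (z : Z) :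
    IsGreatest (Set.range fun σ : Plan Z N => planValue β r P σ z) (vmax ψ z) := by
  obtain ⟨h1, C, hC, h2⟩ := (mem_wBoundedProd_iff W.pos).1 hψ
  have hsum := W.hasSum_sub_planValue (measurable_vmax h1) hC fun z => abs_vmax_le fun i => h2 i z
  have hloss : ∀ i z, r i z + β * ∫ z', vmax ψ z' ∂(P i z) = ψ i z := fun i z =>
    congrFun (congrFun hfix i) z
  -- By the fixed point equation the one-step value of an alternative `i` is `ψ i`, so the
  -- period-`t` term is the loss from not choosing a maximizer.
  simp only [hloss] at hsum
  constructor
  · obtain ⟨s, hs, hs'⟩ := exists_measurable_argmax h1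
    -- The stationary plan that maximizes at the current state: all its losses vanish.
    refine ⟨⟨fun t x => s (x ⟨t, Finset.mem_Iic.2 le_rfl⟩),
      fun t => hs.comp (measurable_pi_apply _)⟩, ?_⟩
    refine (sub_eq_zero.1 ((hsum _ z).unique ?_)).symm
    refine hasSum_zero.congr_fun fun t => ?_
    refine integral_eq_zero_of_ae (ae_of_all _ fun ω => ?_)
    exact mul_eq_zero_of_right _ (sub_eq_zero.2 (hs' (ω t)).symm)
  · rintro _ ⟨σ, rfl⟩
    exact sub_nonneg.1 ((hsum σ z).nonneg fun t => integral_nonneg fun ω =>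
      mul_nonneg (pow_nonneg W.discount_nonneg t) (sub_nonneg.2 (le_vmax ψ _ _)))

/-- The supremum is attained, so the default value of `⨆` on unbounded families plays no role. -/
lemma valueFun_eq_vmax (W : IsWeight β r P k c A) {ψ : Fin N → Z → ℝ}
    (hψ : ψ ∈ wBoundedProd N k) (hfix : jovanovicOp β r P ψ = ψ) :
    valueFun β r P = vmax ψ :=
  funext fun z => (W.isGreatest_planValue hψ hfix z).csSup_eq

lemma eq_contValue (W : IsWeight β r P k c A) {ψ : Fin N → Z → ℝ}
    (hψ : ψ ∈ wBoundedProd N k) (hfix : jovanovicOp β r P ψ = ψ) : ψ = contValue β r P := by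
  ext i z
  rw [contValue, W.valueFun_eq_vmax hψ hfix]
  exact (congrFun (congrFun hfix i) z).symm

end IsWeight

/-! ### The concrete weight function. -/

section Weight

variable {r : Fin N → Z → ℝ} {P : Fin N → Kernel Z Z} [∀ i, IsMarkovKernel (P i)] {g : Z → ℝ}

lemma integrable_of_lintegral_ofReal_le {μ : Measure Z} {f : Z → ℝ} (hf : Measurable f)
    (hf0 : ∀ z, 0 ≤ f z) {C : ℝ} (hC : 0 ≤ C)
    (h : ∫⁻ z, ENNReal.ofReal (f z) ∂μ ≤ ENNReal.ofReal C) :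
    Integrable f μ ∧ ∫ z, f z ∂μ ≤ C := by
  refine ⟨⟨hf.aestronglyMeasurable, ?_⟩, ?_⟩
  · rw [hasFiniteIntegral_iff_ofReal (ae_of_all _ hf0)]
    exact h.trans_lt ENNReal.ofReal_lt_top
  · rw [integral_eq_lintegral_of_nonneg_ae (ae_of_all _ hf0) hf.aestronglyMeasurable]
    exact ENNReal.toReal_le_of_le_ofReal hC h

/-- With `c = N m' + m`, the two moment bounds give `P_i k ≤ N m' g + (m g + d) + d' = c g + d +
d'`. The condition on `d'` says precisely that `d + d' ≤ c d'`, so the right side is at most `c (g +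
d') ≤ c k`. The payoff factor `m'⁻¹` comes from `m' |r_i| ≤ k`. -/
lemma isWeight_weight {β : ℝ} (hβ0 : 0 < β) (hr : ∀ i, Measurable (r i))
    (hg : Measurable g) (hg0 : ∀ z, 0 ≤ g z) {m d : ℝ} (hm : 0 ≤ m) (hd : 0 ≤ d)
    (hbound : ∀ z i j, ∫⁻ z', ENNReal.ofReal |r i z'| ∂(P j z) ≤ ENNReal.ofReal (g z))
    (hdrift : ∀ z i, ∫⁻ z', ENNReal.ofReal (g z') ∂(P i z) ≤ ENNReal.ofReal (m * g z + d))
    {m' d' : ℝ} (hm' : 0 < m') (hd' : 0 < d')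
    (hgt : 1 < N * m' + m) (hlt : β * (N * m' + m) < 1)
    (hdd : d / (N * m' + m - 1) ≤ d') :
    IsWeight β r P (weight r g m' d') (N * m' + m) m'⁻¹ := by
  have hS0 : ∀ z, 0 ≤ ∑ i, |r i z| := fun z => Finset.sum_nonneg fun i _ => abs_nonneg _
  have hrI : ∀ i j z, Integrable (fun z' => |r i z'|) (P j z) ∧ ∫ z', |r i z'| ∂(P j z) ≤ g z :=
    fun i j z => integrable_of_lintegral_ofReal_le (hr i).abs (fun _ => abs_nonneg _) (hg0 z)
      (hbound z i j)
  have hgI : ∀ i z, Integrable g (P i z) ∧ ∫ z', g z' ∂(P i z) ≤ m * g z + d := fun i z =>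
    integrable_of_lintegral_ofReal_le hg hg0 (add_nonneg (mul_nonneg hm (hg0 z)) hd) (hdrift z i)
  have hSI : ∀ i z, Integrable (fun z' => m' * ∑ j, |r j z'|) (P i z) := fun i z =>
    (integrable_finsetSum _ fun j _ => (hrI j i z).1).const_mul m'
  have hSgI : ∀ i z, Integrable (fun z' => m' * ∑ j, |r j z'| + g z') (P i z) := fun i z =>
    (hSI i z).add (hgI i z).1
  have hd2 : d ≤ d' * (N * m' + m - 1) := (div_le_iff₀ (by linarith)).1 hdd
  refine
    { discount_nonneg := hβ0.le
      measurable_payoff := hr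
      measurable := ?_
      pos := fun z => ?_
      integrable := fun i z => (hSgI i z).add (integrable_const d')
      integral_le := fun i z => ?_
      abs_payoff_le := fun i z => ?_
      growth_nonneg := by linarith
      bound_nonneg := (inv_pos.2 hm').le
      discount_lt := hlt }
  · exact (((Finset.measurable_fun_sum _ fun i _ => (hr i).abs).const_mul m').add hg).add_const d'
  · have := mul_nonneg hm'.le (hS0 z)
    have := hg0 z
    rw [weight]
    linarith
  · have h1 : ∑ j, ∫ z', |r j z'| ∂(P i z) ≤ N * g z :=
      (Finset.sum_le_card_nsmul _ _ _ fun j _ => (hrI j i z).2).trans_eq (by simp)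
    have h2 : ∫ z', weight r g m' d' z' ∂(P i z) =
        m' * ∑ j, ∫ z', |r j z'| ∂(P i z) + ∫ z', g z' ∂(P i z) + d' := by
      simp only [weight]
      rw [integral_add (hSgI i z) (integrable_const d'),
        integral_add (hSI i z) (hgI i z).1, integral_const_mul,
        integral_finsetSum _ fun j _ => (hrI j i z).1]
      simp
    have h3 := mul_le_mul_of_nonneg_left h1 hm'.le
    -- The term `c m' ∑ |r_j|` of `c k` is not needed for the bound and is discarded as nonnegative.
    have h4 := mul_nonneg (by linarith : (0 : ℝ) ≤ N * m' + m) (mul_nonneg hm'.le (hS0 z))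
    rw [h2, weight]
    linarith [(hgI i z).2]
  · have h1 : |r i z| ≤ ∑ j, |r j z| :=
      Finset.single_le_sum (f := fun j => |r j z|) (fun j _ => abs_nonneg _) (Finset.mem_univ i)
    rw [← div_eq_inv_mul, le_div_iff₀' hm', weight]
    linarith [mul_le_mul_of_nonneg_left h1 hm'.le, hg0 z]

end Weight

end SeqDecision

open SeqDecision in
theorem mainTheorem3 {Z : Type*} [MeasurableSpace Z] {N : ℕ} [NeZero N]
    (β : ℝ) (hβ0 : 0 < β) (hβ1 : β < 1)
    (r : Fin N → Z → ℝ) (hr : ∀ i, Measurable (r i))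
    (P : Fin N → Kernel Z Z) [∀ i, IsMarkovKernel (P i)]
    (g : Z → ℝ) (hg : Measurable g) (hg0 : ∀ z, 0 ≤ g z)
    (m d : ℝ) (hm : 0 ≤ m) (hd : 0 ≤ d) (hβm : β * m < 1)
    (hbound : ∀ z i j, ∫⁻ z', ENNReal.ofReal |r i z'| ∂(P j z) ≤ ENNReal.ofReal (g z))
    (hdrift : ∀ z i, ∫⁻ z', ENNReal.ofReal (g z') ∂(P i z) ≤ ENNReal.ofReal (m * g z + d))
    (m' d' : ℝ) (hm' : 0 < m') (hd' : 0 < d')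
    (hgt : 1 < N * m' + m) (hlt : β * (N * m' + m) < 1)
    (hdd : d / (N * m' + m - 1) ≤ d') :
    -- the value function is well defined
    (∀ σ z, (∀ᵐ ω ∂(law P σ z), Summable fun t => payoff β r σ t ω) ∧
      Integrable (totalPayoff β r σ) (law P σ z)) ∧
    (∀ z, BddAbove (Set.range fun σ : Plan Z N => planValue β r P σ z)) ∧
    (∀ i z, Integrable (valueFun β r P) (P i z)) ∧
    -- it is the maximum of the continuation values
    valueFun β r P = vmax (contValue β r P) ∧
    -- the operator is a well-defined self-map of the product space
    (∀ ψ ∈ wBoundedProd N (weight r g m' d'), (∀ i z, Integrable (vmax ψ) (P i z)) ∧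
      jovanovicOp β r P ψ ∈ wBoundedProd N (weight r g m' d')) ∧
    -- it is a contraction of modulus `β (N m' + m) < 1`
    (∀ ψ ∈ wBoundedProd N (weight r g m' d'), ∀ φ ∈ wBoundedProd N (weight r g m' d'),
      wdist (weight r g m' d') (jovanovicOp β r P ψ) (jovanovicOp β r P φ) ≤
        β * (N * m' + m) * wdist (weight r g m' d') ψ φ) ∧
    -- its unique fixed point is the vector of continuation values
    contValue β r P ∈ wBoundedProd N (weight r g m' d') ∧
    jovanovicOp β r P (contValue β r P) = contValue β r P ∧
    (∀ ψ ∈ wBoundedProd N (weight r g m' d'), jovanovicOp β r P ψ = ψ →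
      ψ = contValue β r P) := by
  have W : IsWeight β r P (weight r g m' d') (N * m' + m) m'⁻¹ :=
    isWeight_weight hβ0 hr hg hg0 hm hd hbound hdrift hm' hd' hgt hlt hdd
  obtain ⟨ψ, hψ, hfix⟩ := W.exists_fixedPoint
  have hv := W.valueFun_eq_vmax hψ hfix
  -- From here on the fixed point found by iteration is `contValue β r P` itself.
  obtain rfl := W.eq_contValue hψ hfix
  exact ⟨W.ae_summable_and_integrable_totalPayoff,
    fun z => (W.isGreatest_planValue hψ hfix z).bddAbove,
    fun i z => hv ▸ W.integrable_vmax hψ i z, hv,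
    fun φ hφ => ⟨W.integrable_vmax hφ, W.jovanovicOp_mem hφ⟩,
    fun φ hφ χ hχ => W.wdist_jovanovicOp_le hφ hχ, hψ, hfix, fun φ hφ h => W.eq_contValue hφ h⟩
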